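/- For integers $m \ge 1$ and $n \ge 0$, let $\mathrm{CLF}'(m,n)$ be the (multi)graph with boundary whose vertex set is $V=\{(x,y) \in \mathbb{Z}/2m \times \{0,\dots,n+1\} : x+y \text{ even}\}$, whose boundary vertex set $\partial V$ consists of the vertices with $y \in \{0,n+1\}$, and which has one edge joining $(x,y)$ to $(x+1,y+\epsilon)$ for each vertex $(x,y)$ and each $\epsilon\in\{1,-1\}$ with $y+\epsilon\in\{0,\dots,n+1\}$ (so that for $m=1$ there are pairs of parallel edges). Let $L_{\mathrm{std}}$ be the standard graph Laplacian, $(L_{\mathrm{std}}u)(x) = \sum_{e} (u(x)-u(e_-))$, where $e$ runs over the oriented edges starting at $x$ and $e_-$ is the endpoint of $e$. Let $$\mathcal{U}_0(\mathrm{CLF}'(m,n),L_{\mathrm{std}},\mathbb{Q}/\mathbb{Z}) = \{u : V \to \mathbb{Q}/\mathbb{Z} \;:\; L_{\mathrm{std}}u = 0 \text{ on all of } V,\ u = 0 \text{ on } \partial V\}.$$ Then, as $\mathbb{Z}$-modules, $$\mathcal{U}_0(\mathrm{CLF}'(m,n),L_{\mathrm{std}},\mathbb{Q}/\mathbb{Z})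 \cong \begin{cases} (\mathbb{Z}/2)^n, & m \text{ odd},\\[4pt] \displaystyle\bigoplus_{j=1}^{\lceil n/2\rceil} \mathbb{Z}/\gcd(4^j,4m) \;\oplus\; \bigoplus_{j=1}^{\lfloor n/2\rfloor} \mathbb{Z}/\gcd(4^j,4m), & m \text{ even}.\end{cases}$$ -/

import Mathlib

open scoped DirectSum

/-- A graph with boundary: a countable, locally finite, undirected multigraph, given by its set `E`
of oriented edges with a fixed-point-free orientation reversal, together with a partition of the
vertex set into boundary vertices (the set `bdry`) and interior vertices (its complement). -/
structure BoundaryGraph where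
  V : Type
  E : Type
  /-- starting vertex of an oriented edge -/
  src : E → V
  /-- ending vertex of an oriented edge -/
  tgt : E → V
  /-- reversal of the orientation -/
  rev : E → E
  rev_rev : ∀ e, rev (rev e) = e
  rev_ne : ∀ e, rev e ≠ e
  src_rev : ∀ e, src (rev e) = tgt e
  countable_V : Countable V
  locallyFinite : ∀ x, {e : E | src e = x}.Finite
  bdry : Set V

namespace BoundaryGraph

/-- The finite set of oriented edges exiting the vertex `x`. -/
noncomputable def star (G : BoundaryGraph) (x : G.V) : Finset G.E :=
  (G.locallyFinite x).toFinset

end BoundaryGraph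

/-- An `R`-network: a graph with boundary and a generalized Laplacian on it, the latter given by
symmetric edge weights `w : E → R` and a diagonal term `d : V → R`. -/
structure RNetwork (R : Type) [CommRing R] where
  graph : BoundaryGraph
  w : graph.E → R
  w_rev : ∀ e, w (graph.rev e) = w e
  d : graph.V → R

namespace RNetwork

variable {R : Type} [CommRing R]

/-- The generalized Laplacian acting on functions `u : V → M`:
`(L u)(x) = d(x) u(x) + ∑_{e exiting x} w(e) (u(x) - u(end of e))`. -/
noncomputable def laplacian (N : RNetwork R) (M : Type) [AddCommGroup M] [Module R M] :
    (N.graph.V → M) →ₗ[R] (N.graph.V → M) where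
  toFun u x := N.d x • u x + ∑ e ∈ N.graph.star x, N.w e • (u x - u (N.graph.tgt e))
  map_add' u v := by
    funext x
    simp only [Pi.add_apply, smul_add, add_sub_add_comm, Finset.sum_add_distrib]
    abel
  map_smul' c u := by
    funext x
    simp only [Pi.smul_apply, RingHom.id_apply, smul_add, Finset.smul_sum, ← smul_sub,
      smul_comm c]

/-- The module `U₀(G, L, M)` of finitely supported functions `u : V → M` such that `L u = 0` at
every vertex and `u = 0` on the boundary. -/
noncomputable def U₀ (N : RNetwork R) (M : Type) [AddCommGroup M] [Module R M] :
    Submodule R (N.graph.V → M) where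
  carrier := {u | (Function.support u).Finite ∧ N.laplacian M u = 0 ∧ ∀ x ∈ N.graph.bdry, u x = 0}
  zero_mem' := by simp
  add_mem' := by
    rintro u v ⟨hu, hLu, hu0⟩ ⟨hv, hLv, hv0⟩
    refine ⟨(hu.union hv).subset (Function.support_add u v), ?_, fun x hx => ?_⟩
    · rw [map_add, hLu, hLv, add_zero]
    · rw [Pi.add_apply, hu0 x hx, hv0 x hx, add_zero]
  smul_mem' := by
    rintro c u ⟨hu, hLu, hu0⟩
    refine ⟨hu.subset (Function.support_const_smul_subset c u), ?_, fun x hx => ?_⟩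
    · rw [map_smul, hLu, smul_zero]
    · rw [Pi.smul_apply, hu0 x hx, smul_zero]

end RNetwork

/-- The `ℤ`-network `(G, L_std)`: all edge weights are `1` and the diagonal term is `0`. -/
def stdNetwork (G : BoundaryGraph) : RNetwork ℤ where
  graph := G
  w _ := 1
  w_rev _ := rfl
  d _ := 0

/-- Vertices of `CLF'(m, n)`: pairs `(x, y) ∈ ℤ/2m × {0, …, n+1}` with `x + y` even. -/
abbrev CLFVertex (m n : ℕ) : Type :=
  {p : ZMod (2 * m) × Fin (n + 2) //
    ZMod.castHom (dvd_mul_right 2 m) (ZMod 2) p.1 + ((p.2 : ℕ) : ZMod 2) = 0}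

/-- `CLFStep p q` says that `p = (x, y)` and `q = (x + 1, y ± 1)`. -/
def CLFStep {m n : ℕ} (p q : CLFVertex m n) : Prop :=
  q.1.1 = p.1.1 + 1 ∧ ((q.1.2 : ℕ) = p.1.2 + 1 ∨ (p.1.2 : ℕ) = q.1.2 + 1)

/-- Oriented edges of `CLF'(m, n)`. There is one unoriented edge for each pair `(p, q)` with
`CLFStep p q`; the oriented edge `(p, q, true)` runs along it from `p` to `q`, and `(q, p, false)`
runs back. For `m = 1`, where `x + 1 = x - 1`, this produces pairs of parallel edges. -/
abbrev CLFEdge (m n : ℕ) : Type :=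
  {t : CLFVertex m n × CLFVertex m n × Bool //
    if t.2.2 = true then CLFStep t.1 t.2.1 else CLFStep t.2.1 t.1}

/-- The graph with boundary `CLF'(m, n)`, for `m ≥ 1`; its boundary consists of the rows `y = 0` and
`y = n + 1`. -/
def CLF' (m n : ℕ) [NeZero m] : BoundaryGraph where
  V := CLFVertex m n
  E := CLFEdge m n
  src e := e.1.1
  tgt e := e.1.2.1
  rev e := ⟨(e.1.2.1, e.1.1, !e.1.2.2), by
    obtain ⟨⟨p, q, b⟩, h⟩ := e
    cases b <;> simpa using h⟩
  rev_rev e := by simp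
  rev_ne e h := by
    have h' := congrArg (fun t : CLFEdge m n => t.1.2.2) h
    simp at h'
  src_rev _ := rfl
  countable_V := inferInstance
  locallyFinite _ := Set.toFinite _
  bdry := {p | (p.1.2 : ℕ) = 0 ∨ (p.1.2 : ℕ) = n + 1}

/-! Read a function on the graph as rows `a y : ℤ → A`, periodic of period 2m and supported on x + y
even, and put (S f)(x) = f(x+1) + f(x-1). Harmonicity with zero boundary values says a 0 = a (n+1) =
0, S (a 1) = 0 and S (a (y+2) + a y) = 4 a (y+1). Since S is applied to sums of two rows, this does
not directly express the values at x+1 through those at x and x-1.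

An invertible integral change of variables repairs this. Put a, shifted by one, as row 0 of a
finitely supported array with c k (j+2) = c (k+1) j + c (k+1) (j+2). The harmonic equations become S
(c k (j+1)) = 4 c (k+1) j, and columns 0 and 1, interleaved into one sequence t, satisfy S t = 4 B t
with B = `zigzag`. The array is recovered from row 0 as well as from its first two columns
(`harmonicSeqEquivZigzagSeq`).

Now t(x+1) = 4 B t(x) - t(x-1). Periodicity aside, t is therefore determined by its values at x = 0,
1, one of which is zero by parity for each i. The only constraint on the other is 4^(i/2) t i = 0,
forced by t 0 = t 1 = 0 (`torsionZigzagSeq.eval`).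

For periodicity, the shift by two acts on t as 4C - 1, where C is B followed by a unit shift, so the
condition is ((4C-1)^m - 1) t = 0. In ℤ[X] the polynomial (4X-1)^m - 1 is 2(1 + 2E) for m odd and
2^(s+3) X (1 + 2E) for m = 2^(s+1) r with r odd. On 2-power torsion 1 + 2E and r act injectively,
and e C t = 0 exactly when e t = 0. Periodicity thus means d t = 0 with d = 2 or d = 4m. What
remains is the product over 2 ≤ i ≤ n+1 of the gcd(4^(i/2), d)-torsion of ℚ/ℤ, each factor cyclic;
for m even, the even and the odd i give the two sums. -/

/-- A sequence that vanishes eventually and whose vanishing propagates downwards is zero. -/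
theorem eq_zero_of_descending {F : Type*} [Zero F] {d : ℕ → F} {s N : ℕ} (hs : 0 < s)
    (hN : ∀ i, N < i → d i = 0) (h : ∀ i, d (i + s) = 0 → d i = 0) (i : ℕ) : d i = 0 := by
  induction hk : N + 1 - i using Nat.strong_induction_on generalizing i with
  | _ k ih =>
    by_cases hi : N < i
    · exact hN i hi
    · exact h i (ih (N + 1 - (i + s)) (by omega) (i + s) rfl)

theorem sum_range_neg_one_pow_smul_add_succ {F : Type*} [AddCommGroup F] (r : ℕ → F) (N : ℕ) :
    ∑ l ∈ Finset.range N, (-1 : ℤ) ^ l • r l + ∑ l ∈ Finset.range N, (-1 : ℤ) ^ l • r (l + 1) =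
      r 0 - (-1 : ℤ) ^ N • r N := by
  induction N with
  | zero => simp
  | succ N ih =>
    rw [Finset.sum_range_succ, Finset.sum_range_succ, add_add_add_comm, ih, pow_succ]
    module

theorem apply_two_mul_add {β : Type*} {G : ℕ → β} (hG : ∀ j, G (j + 2) = G j) (k j : ℕ) :
    G (2 * k + j) = G j := by
  induction k with
  | zero => simp
  | succ k ih => rw [← ih, ← hG (2 * k + j)]; congr 1; ring

/-! ### Change of variables from harmonic to zigzag sequences -/

section Arrays

variable {F : Type*} [AddCommGroup F]

/-- Sequences `a 0, …, a (n + 1)` of elements of `F`, vanishing at both ends and satisfying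
`S (a (y + 1) + a (y - 1)) = 4 a y`. -/
def harmonicSeq (S : F →+ F) (G : ℕ → AddSubgroup F) (n : ℕ) : AddSubgroup (ℕ → F) where
  carrier := {a | a 0 = 0 ∧ (∀ y, n < y → a y = 0) ∧ (∀ y, a y ∈ G (y + 1)) ∧ S (a 1) = 0 ∧
    ∀ y, S (a (y + 2) + a y) = (4 : ℤ) • a (y + 1)}
  zero_mem' := by simp
  add_mem' := by
    rintro a b ⟨h1, h2, h3, h4, h5⟩ ⟨k1, k2, k3, k4, k5⟩
    refine ⟨by simp [h1, k1], fun y hy => by simp [h2 y hy, k2 y hy],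
      fun y => add_mem (h3 y) (k3 y), by simp [h4, k4], fun y => ?_⟩
    simp only [Pi.add_apply, smul_add, ← h5, ← k5, ← map_add]
    congr 1
    abel
  neg_mem' := by
    rintro a ⟨h1, h2, h3, h4, h5⟩
    refine ⟨by simp [h1], fun y hy => by simp [h2 y hy],
      fun y => neg_mem (h3 y), by simp [h4], fun y => ?_⟩
    simp only [Pi.neg_apply, smul_neg, ← h5, ← map_neg]
    congr 1
    abel

/-- The operator `t ↦ B t` with `(B t) (2k) = t (2k + 1) - t (2k + 3)` and
`(B t) (2k + 1) = t (2k + 2)`. -/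
def zigzag (F : Type*) [AddCommGroup F] : (ℕ → F) →+ (ℕ → F) where
  toFun t i := if Even i then t (i + 1) - t (i + 3) else t (i + 1)
  map_zero' := by ext; simp
  map_add' s t := by
    ext i
    by_cases hi : Even i <;> simp [hi]
    abel

theorem zigzag_even (t : ℕ → F) (k : ℕ) :
    zigzag F t (2 * k) = t (2 * k + 1) - t (2 * (k + 1) + 1) := by
  simp [zigzag, mul_add]

theorem zigzag_odd (t : ℕ → F) (k : ℕ) : zigzag F t (2 * k + 1) = t (2 * (k + 1)) := by
  simp [zigzag, mul_add, parity_simps]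

/-- Sequences `t 2, …, t (n + 1)` of elements of `F`, extended by zero, on which `S` acts as
`4 B` with `B` the operator `zigzag`. -/
def zigzagSeq (S : F →+ F) (G : ℕ → AddSubgroup F) (n : ℕ) : AddSubgroup (ℕ → F) where
  carrier := {t | t 0 = 0 ∧ t 1 = 0 ∧ (∀ i, n + 1 < i → t i = 0) ∧ (∀ i, t i ∈ G i) ∧
    ∀ i, S (t i) = (4 : ℤ) • zigzag F t i}
  zero_mem' := by simp
  add_mem' := by
    rintro a b ⟨h1, h2, h3, h4, h5⟩ ⟨k1, k2, k3, k4, k5⟩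
    exact ⟨by simp [h1, k1], by simp [h2, k2], fun y hy => by simp [h3 y hy, k3 y hy],
      fun y => add_mem (h4 y) (k4 y), fun y => by simp [h5, k5]⟩
  neg_mem' := by
    rintro a ⟨h1, h2, h3, h4, h5⟩
    exact ⟨by simp [h1], by simp [h2], fun y hy => by simp [h3 y hy],
      fun y => neg_mem (h4 y), fun y => by simp [h5]⟩

/-- Triangular arrays whose row `c 0` is a (shifted) harmonic sequence and whose columns `c · 0`,
`c · 1` form a zigzag sequence. -/
def zigzagArray (S : F →+ F) (G : ℕ → AddSubgroup F) (n : ℕ) : AddSubgroup (ℕ → ℕ → F) where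
  carrier := {c | c 0 0 = 0 ∧ c 0 1 = 0 ∧ (∀ k j, n + 1 < 2 * k + j → c k j = 0) ∧
    (∀ k j, c k j ∈ G j) ∧ (∀ k j, c k (j + 2) = c (k + 1) j + c (k + 1) (j + 2)) ∧
    (∀ k j, S (c k (j + 1)) = (4 : ℤ) • c (k + 1) j) ∧
    -- This is the preceding condition at j = -1, with c (k+1) (-1) read off from the recurrence.
    ∀ k, S (c k 0) = (4 : ℤ) • (c k 1 - c (k + 1) 1)}
  zero_mem' := by simp
  add_mem' := by
    rintro a b ⟨h1, h2, h3, h4, h5, h6, h7⟩ ⟨k1, k2, k3, k4, k5, k6, k7⟩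
    refine ⟨by simp [h1, k1], by simp [h2, k2], fun i j hy => by simp [h3 i j hy, k3 i j hy],
      fun i j => add_mem (h4 i j) (k4 i j), fun i j => ?_, fun i j => by simp [h6, k6],
      fun i => ?_⟩
    · simp only [Pi.add_apply, h5 i j, k5 i j]
      abel
    · simp only [Pi.add_apply, map_add, h7, k7]
      module
  neg_mem' := by
    rintro a ⟨h1, h2, h3, h4, h5, h6, h7⟩
    refine ⟨by simp [h1], by simp [h2], fun i j hy => by simp [h3 i j hy],
      fun i j => neg_mem (h4 i j), fun i j => ?_, fun i j => by simp [h6], fun i => ?_⟩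
    · simp only [Pi.neg_apply, h5 i j]
      abel
    · simp only [Pi.neg_apply, map_neg, h7]
      module

variable {S : F →+ F} {G : ℕ → AddSubgroup F} {n : ℕ}

/-- The first row of a zigzag array. -/
def zigzagArray.row : zigzagArray S G n →+ harmonicSeq S G n where
  toFun c := ⟨fun j => c.1 0 (j + 1), by
    obtain ⟨c, h1, h2, h3, h4, h5, h6, h7⟩ := c
    refine ⟨h2, fun y hy => h3 _ _ (by omega), fun y => h4 _ _, ?_, fun y => ?_⟩
    · have := h7 0
      rw [h1, h2, map_zero, zero_sub, smul_neg, eq_comm, neg_eq_zero] at this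
      rw [h6, this]
    · change S (c 0 (y + 2 + 1) + c 0 (y + 1)) = (4 : ℤ) • c 0 (y + 1 + 1)
      rw [map_add, h6, h6, ← smul_add, add_comm, ← h5]⟩
  map_zero' := rfl
  map_add' _ _ := rfl

/-- The first two columns of a zigzag array. -/
def zigzagArray.columns (hG : ∀ j, G (j + 2) = G j) : zigzagArray S G n →+ zigzagSeq S G n where
  toFun c := ⟨fun i => c.1 (i / 2) (i % 2), by
    obtain ⟨c, h1, h2, h3, h4, h5, h6, h7⟩ := c
    refine ⟨h1, h2, fun i hi => h3 _ _ (by omega), fun i => ?_, fun i => ?_⟩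
    · rw [← Nat.div_add_mod i 2, apply_two_mul_add hG, Nat.div_add_mod]
      exact h4 _ _
    · obtain ⟨k, rfl | rfl⟩ := Nat.even_or_odd' i
      · have e1 : (2 * k + 1) / 2 = k := by omega
        have e2 : (2 * (k + 1) + 1) / 2 = k + 1 := by omega
        simp [zigzag_even, h7, e1, e2, Nat.add_mod]
      · have e1 : (2 * k + 1) / 2 = k := by omega
        simp [zigzag_odd, h6, e1, Nat.add_mod]⟩
  map_zero' := rfl
  map_add' _ _ := rfl

theorem zigzagArray.row_injective :
    Function.Injective (zigzagArray.row (S := S) (G := G) (n := n)) := by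
  rw [injective_iff_map_eq_zero]
  rintro ⟨c, h1, h2, h3, h4, h5, h6, h7⟩ hc
  have h0 : ∀ j, c 0 (j + 1) = 0 := fun j => congrFun (congrArg Subtype.val hc) j
  refine Subtype.ext (funext fun k => funext ?_)
  induction k with
  | zero => rintro (_ | j) <;> [exact h1; exact h0 j]
  | succ k ih =>
    refine eq_zero_of_descending (s := 2) (N := n + 1) two_pos (fun j hj => h3 _ _ (by omega))
      fun j hj => ?_
    have := h5 k j
    rw [show c (k + 1) (j + 2) = 0 from hj, add_zero] at this
    exact this.symm.trans (ih _)

theorem zigzagArray.columns_injective (hG : ∀ j, G (j + 2) = G j) :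
    Function.Injective (zigzagArray.columns (S := S) (n := n) hG) := by
  rw [injective_iff_map_eq_zero]
  rintro ⟨c, h1, h2, h3, h4, h5, h6, h7⟩ hc
  have h0 : ∀ i, c (i / 2) (i % 2) = 0 := fun j => congrFun (congrArg Subtype.val hc) j
  have key : ∀ j k, c k j = 0 := by
    intro j
    induction j using Nat.twoStepInduction with
    | zero => intro k; simpa using h0 (2 * k)
    | one =>
      intro k
      have := h0 (2 * k + 1)
      rwa [show (2 * k + 1) / 2 = k by omega, show (2 * k + 1) % 2 = 1 by omega] at this
    | more j ih _ =>
      refine eq_zero_of_descending (s := 1) (N := n + 1) one_pos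
        (fun k hk => h3 _ _ (by omega)) fun k hk => ?_
      rw [h5, ih, hk, add_zero]
  exact Subtype.ext (funext fun k => funext fun j => key j k)

/-- The array with first row `0, a 0, a 1, …`. -/
def arrayOfRow (n : ℕ) (a : ℕ → F) : ℕ → ℕ → F
  | 0, 0 => 0
  | 0, j + 1 => a j
  -- The finitely supported solution of the recurrence for row k+1; `n + 2` terms reach past the
  -- support.
  | k + 1, j => ∑ l ∈ Finset.range (n + 2), (-1 : ℤ) ^ l • arrayOfRow n a k (j + 2 + 2 * l)

theorem zigzagArray.row_surjective (hG : ∀ j, G (j + 2) = G j) :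
    Function.Surjective (zigzagArray.row (S := S) (G := G) (n := n)) := by
  rintro ⟨a, h1, h2, h3, h4, h5⟩
  set c := arrayOfRow n a with hc
  have c0 : c 0 0 = 0 := by simp [hc, arrayOfRow]
  have c1 : ∀ j, c 0 (j + 1) = a j := fun j => by simp [hc, arrayOfRow]
  have c2 : ∀ k j, c (k + 1) j =
      ∑ l ∈ Finset.range (n + 2), (-1 : ℤ) ^ l • c k (j + 2 + 2 * l) := fun k j => by
    simp [hc, arrayOfRow]
  have hsupp : ∀ k j, n + 1 < 2 * k + j → c k j = 0 := by
    intro k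
    induction k with
    | zero =>
      rintro (_ | j) hj
      · exact c0
      · rw [c1]; exact h2 _ (by omega)
    | succ k ih =>
      intro j hj
      rw [c2]
      exact Finset.sum_eq_zero fun l _ => by rw [ih _ (by omega), smul_zero]
  have hmem : ∀ k j, c k j ∈ G j := by
    intro k
    induction k with
    | zero =>
      rintro (_ | j)
      · rw [c0]; exact zero_mem _
      · rw [c1]; exact h3 j
    | succ k ih =>
      intro j
      rw [c2]
      refine sum_mem fun l _ => zsmul_mem ?_ _
      have := ih (j + 2 + 2 * l)
      rwa [add_comm (j + 2), apply_two_mul_add hG, hG, add_comm (2 * l)] at this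
  have hrec : ∀ k j, c k (j + 2) = c (k + 1) j + c (k + 1) (j + 2) := by
    intro k j
    have := sum_range_neg_one_pow_smul_add_succ (fun l => c k (j + 2 + 2 * l)) (n + 2)
    simp only [hsupp k (j + 2 + 2 * (n + 2)) (by omega), smul_zero, sub_zero, mul_zero,
      add_zero] at this
    rw [← this, c2, c2]
    congr 1
    refine Finset.sum_congr rfl fun l _ => ?_
    congr 2
    ring
  have hS : ∀ k j, S (c k (j + 1)) = (4 : ℤ) • c (k + 1) j := by
    -- The defect d j = S (c k (j+1)) - 4 c (k+1) j satisfies d j = -d (j+2) and vanishes for large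
    -- j. The claim for row k supplies the hypothesis for row k+1.
    have desc : ∀ k, (∀ j, S (c k (j + 1)) + S (c k (j + 3)) = (4 : ℤ) • c k (j + 2)) →
        ∀ j, S (c k (j + 1)) = (4 : ℤ) • c (k + 1) j := by
      intro k h j
      rw [← sub_eq_zero]
      refine eq_zero_of_descending (s := 2) (N := n + 1)
        (d := fun j => S (c k (j + 1)) - (4 : ℤ) • c (k + 1) j) two_pos (fun j hj => ?_)
        (fun j hj => ?_) j
      · rw [hsupp _ _ (by omega), hsupp _ _ (by omega)]; simp
      · have h' := h j
        rw [hrec k j, smul_add] at h'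
        have hj' := sub_eq_zero.1 hj
        rw [show j + 2 + 1 = j + 3 by rfl] at hj'
        rw [hj', add_left_inj] at h'
        exact sub_eq_zero.2 h'
    intro k
    induction k with
    | zero =>
      refine desc 0 fun j => ?_
      rw [c1, c1, c1, add_comm, ← map_add, h5]
    | succ k ih =>
      refine desc (k + 1) fun j => ?_
      rw [← map_add, ← hrec k (j + 1), ← ih]
  -- The boundary equation S (a 1) = 0 enters at k = 0.
  have hS0 : ∀ k, S (c k 0) = (4 : ℤ) • (c k 1 - c (k + 1) 1) := by
    rintro (_ | k)
    · rw [c0, map_zero, smul_sub, ← hS, c1, c1, h1, h4, smul_zero, sub_zero]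
    · rw [smul_sub, ← hS (k + 1), ← hS k, eq_sub_iff_add_eq, ← map_add, ← hrec]
  exact ⟨⟨c, c0, by rw [c1, h1], hsupp, hmem, hrec, hS, hS0⟩, Subtype.ext (funext c1)⟩

/-- The array with first two columns `t 0, t 2, …` and `t 1, t 3, …`. -/
def arrayOfColumns (n : ℕ) (t : ℕ → F) : ℕ → ℕ → F
  | k, 0 => t (2 * k)
  | k, 1 => t (2 * k + 1)
  | k, j + 2 => ∑ l ∈ Finset.range (n + 2), arrayOfColumns n t (k + 1 + l) j

theorem zigzagArray.columns_surjective (hG : ∀ j, G (j + 2) = G j) :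
    Function.Surjective (zigzagArray.columns (S := S) (n := n) hG) := by
  rintro ⟨t, h1, h2, h3, h4, h5⟩
  set c := arrayOfColumns n t with hc
  have c0 : ∀ k, c k 0 = t (2 * k) := fun k => by simp [hc, arrayOfColumns]
  have c1 : ∀ k, c k 1 = t (2 * k + 1) := fun k => by simp [hc, arrayOfColumns]
  have c2 : ∀ k j, c k (j + 2) = ∑ l ∈ Finset.range (n + 2), c (k + 1 + l) j := fun k j => by
    simp [hc, arrayOfColumns]
  have hsupp : ∀ j k, n + 1 < 2 * k + j → c k j = 0 := by
    intro j
    induction j using Nat.twoStepInduction with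
    | zero => intro k hk; rw [c0]; exact h3 _ hk
    | one => intro k hk; rw [c1]; exact h3 _ hk
    | more j ih _ =>
      intro k hk
      rw [c2]
      exact Finset.sum_eq_zero fun l _ => ih _ (by omega)
  have hmem : ∀ j k, c k j ∈ G j := by
    intro j
    induction j using Nat.twoStepInduction with
    | zero => intro k; rw [c0, ← apply_two_mul_add hG k]; exact h4 _
    | one => intro k; rw [c1, ← apply_two_mul_add hG k]; exact h4 _
    | more j ih _ =>
      intro k
      rw [c2, hG]
      exact sum_mem fun l _ => ih _
  have hrec : ∀ k j, c k (j + 2) = c (k + 1) j + c (k + 1) (j + 2) := by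
    intro k j
    rw [c2, c2, Finset.sum_range_succ', Finset.sum_range_succ _ (n + 1),
      hsupp j (k + 1 + 1 + (n + 1)) (by omega), add_zero, add_zero, add_comm]
    congr 1
    refine Finset.sum_congr rfl fun l _ => ?_
    congr 1
    ring
  have hS0 : ∀ k, S (c k 0) = (4 : ℤ) • (c k 1 - c (k + 1) 1) := fun k => by
    rw [c0, c1, c1, h5, zigzag_even]
  have hS : ∀ j k, S (c k (j + 1)) = (4 : ℤ) • c (k + 1) j := by
    -- Here the defect S (c k (j+2)) - 4 c (k+1) (j+1) is independent of k, and it vanishes for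
    -- large k.
    have desc : ∀ j, (∀ k, S (c (k + 1) j) = (4 : ℤ) • (c (k + 1) (j + 1) - c (k + 2) (j + 1))) →
        ∀ k, S (c k (j + 2)) = (4 : ℤ) • c (k + 1) (j + 1) := by
      intro j h k
      rw [← sub_eq_zero]
      refine eq_zero_of_descending (s := 1) (N := n + 1)
        (d := fun k => S (c k (j + 2)) - (4 : ℤ) • c (k + 1) (j + 1)) one_pos (fun k hk => ?_)
        (fun k hk => ?_) k
      · rw [hsupp _ _ (by omega), hsupp _ _ (by omega)]; simp
      · have hk' := sub_eq_zero.1 hk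
        rw [hrec, map_add, h k, hk', ← smul_add, sub_add_cancel, sub_self]
    intro j
    induction j using Nat.twoStepInduction with
    | zero => intro k; rw [c1, c0, h5, zigzag_odd]
    | one => exact desc 0 fun k => hS0 (k + 1)
    | more j ih _ =>
      refine desc (j + 1) fun k => ?_
      rw [ih, hrec (k + 1), add_sub_cancel_right]
  refine ⟨⟨c, by rw [c0]; exact h1, by rw [c1]; exact h2, fun k j => hsupp j k,
    fun k j => hmem j k, hrec, fun k j => hS j k, hS0⟩, Subtype.ext (funext fun i => ?_)⟩
  change c (i / 2) (i % 2) = t i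
  obtain ⟨k, rfl | rfl⟩ := Nat.even_or_odd' i
  · simp [c0]
  · rw [show (2 * k + 1) / 2 = k by omega, show (2 * k + 1) % 2 = 1 by omega, c1]

/-- Harmonic sequences correspond to zigzag sequences. -/
noncomputable def harmonicSeqEquivZigzagSeq (hG : ∀ j, G (j + 2) = G j) :
    harmonicSeq S G n ≃+ zigzagSeq S G n :=
  (AddEquiv.ofBijective zigzagArray.row
    ⟨zigzagArray.row_injective, zigzagArray.row_surjective hG⟩).symm.trans
  (AddEquiv.ofBijective (zigzagArray.columns hG)
    ⟨zigzagArray.columns_injective hG, zigzagArray.columns_surjective hG⟩)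

end Arrays
-- The polynomial (4X - 1)^m - 1
open Polynomial

/-- For m odd, 4X divides (4X-1)^m + 1. -/
theorem odd_case_polynomial {m : ℕ} (hm : Odd m) :
    ∃ E : ℤ[X], (4 * X - 1 : ℤ[X]) ^ m - 1 = 2 * (1 + 2 * E) := by
  obtain ⟨D, hD⟩ := hm.add_dvd_pow_add_pow (4 * X - 1 : ℤ[X]) 1
  rw [one_pow] at hD
  exact ⟨X * D - 1, by linear_combination hD⟩

/-- Lifting the exponent: (4X-1)^2 = 1 + 8X(2X-1) with 2X-1 of the form 1 + 2E. An odd power keeps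
the shape, and each squaring (1+w)^2 - 1 = 2w(1 + w/2) contributes one factor 2. -/
theorem even_case_polynomial {r : ℕ} (hr : Odd r) (s : ℕ) :
    ∃ E : ℤ[X], (4 * X - 1 : ℤ[X]) ^ (2 ^ (s + 1) * r) - 1 =
      2 ^ (s + 3) * (X * (1 + 2 * E)) := by
  induction s with
  | zero =>
    obtain ⟨E, hE⟩ : ∃ E : ℤ[X],
        (1 + 8 * (X * (2 * X - 1)) : ℤ[X]) ^ r - 1 = 8 * (X * (2 * X - 1)) * (1 + 2 * E) := by
      obtain ⟨k, rfl⟩ := hr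
      generalize (X * (2 * X - 1) : ℤ[X]) = z
      induction k with
      | zero => exact ⟨0, by ring⟩
      | succ k ih =>
        obtain ⟨E, hE⟩ := ih
        refine ⟨E + (1 + 4 * z) * (1 + 8 * z * (1 + 2 * E)), ?_⟩
        rw [show 2 * (k + 1) + 1 = 2 * k + 1 + 2 by ring, pow_add,
          ← sub_add_cancel ((1 + 8 * z) ^ (2 * k + 1)) 1, hE]
        ring
    refine ⟨X - 1 + E * (2 * X - 1), ?_⟩
    rw [zero_add, pow_one, pow_mul, show (4 * X - 1 : ℤ[X]) ^ 2 = 1 + 8 * (X * (2 * X - 1)) by ring,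
      hE]
    ring
  | succ s ih =>
    obtain ⟨E, hE⟩ := ih
    refine ⟨E + 2 ^ (s + 1) * (X * (1 + 2 * E) ^ 2), ?_⟩
    rw [show 2 ^ (s + 1 + 1) * r = 2 ^ (s + 1) * r * 2 by ring, pow_mul, ← sub_add_cancel
      ((4 * X - 1 : ℤ[X]) ^ (2 ^ (s + 1) * r)) 1, hE]
    ring

/-- Iterating v = -2 E v gives v = (-2)^K E^K v = 0. -/
theorem eq_zero_of_one_add_two_mul {V : Type*} [AddCommGroup V] {E : Module.End ℤ V} {v : V}
    {K : ℕ} (hv : (2 : ℤ) ^ K • v = 0) (h : (1 + 2 * E) v = 0) : v = 0 := by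
  have h1 : v = (-(2 : ℤ)) • E v := by
    have : v + (2 : ℤ) • E v = 0 := by
      rw [← h]
      simp [two_mul, two_smul]
    rw [neg_smul, ← sub_eq_zero, sub_neg_eq_add, this]
  have h2 : ∀ k, v = (-(2 : ℤ)) ^ k • (E ^ k) v := by
    intro k
    induction k with
    | zero => simp
    | succ k ih =>
      rw [pow_succ, pow_succ, mul_smul, Module.End.mul_apply, ← map_smul (E ^ k), ← h1]
      exact ih
  rw [h2 K, neg_pow, mul_smul, ← map_smul, hv, map_zero, smul_zero]

/-! ### Periodicity of zigzag sequences as a torsion condition -/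

section Periodicity

variable {A : Type*} [AddCommGroup A]

/-- The operator `(S f) x = f (x + 1) + f (x - 1)`. -/
def neighborSum (A : Type*) [AddCommGroup A] : (ℤ → A) →+ (ℤ → A) where
  toFun f x := f (x + 1) + f (x - 1)
  map_zero' := by ext; simp
  map_add' f g := by ext; simp only [Pi.add_apply]; abel

/-- The operator `t ↦ B t` followed by a unit shift. -/
def shiftZigzag (A : Type*) [AddCommGroup A] : Module.End ℤ (ℕ → ℤ → A) where
  toFun t i x := zigzag (ℤ → A) t i (x + 1)
  map_add' _ _ := by simp; rfl
  map_smul' _ _ := by simp; rfl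

/-- The shift by two. -/
def shiftTwo (A : Type*) [AddCommGroup A] : Module.End ℤ (ℕ → ℤ → A) where
  toFun t i x := t i (x + 2)
  map_add' _ _ := rfl
  map_smul' _ _ := rfl

theorem shiftTwo_pow_apply (k : ℕ) (t : ℕ → ℤ → A) (i : ℕ) (x : ℤ) :
    (shiftTwo A ^ k) t i x = t i (x + 2 * k) := by
  induction k generalizing x with
  | zero => simp
  | succ k ih =>
    rw [pow_succ', Module.End.mul_apply]
    change (shiftTwo A ^ k) t i (x + 2) = _
    rw [ih]
    congr 1
    push_cast
    ring

theorem shiftTwo_comm_shiftZigzag : Commute (shiftTwo A) (shiftZigzag A) := by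
  ext t i x
  by_cases hi : Even i <;> simp [shiftTwo, shiftZigzag, zigzag, hi, add_right_comm]

theorem aeval_four_mul_X_sub_one {V : Type*} [AddCommGroup V] (C : Module.End ℤ V) :
    aeval C (4 * X - 1 : ℤ[X]) = (4 : ℤ) • C - 1 := by
  rw [show (4 * X - 1 : ℤ[X]) = (4 : ℤ) • X - 1 by simp, map_sub, map_zsmul, aeval_X, map_one]

/-- The equation S t = 4 B t at x+1 reads t(x+2) = 4 (B t)(x+1) - t(x). -/
theorem shiftTwo_eq {t : ℕ → ℤ → A}
    (ht : ∀ i, neighborSum A (t i) = (4 : ℤ) • zigzag (ℤ → A) t i) :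
    shiftTwo A t = aeval (shiftZigzag A) (4 * X - 1 : ℤ[X]) t := by
  ext i x
  have := congrFun (ht i) (x + 1)
  simp only [neighborSum, AddMonoidHom.coe_mk, ZeroHom.coe_mk, Pi.smul_apply, add_sub_cancel_right,
    add_assoc, one_add_one_eq_two] at this
  rw [aeval_four_mul_X_sub_one]
  exact eq_sub_iff_add_eq.2 this

theorem shiftTwo_pow_eq {t : ℕ → ℤ → A}
    (ht : ∀ i, neighborSum A (t i) = (4 : ℤ) • zigzag (ℤ → A) t i) (m : ℕ) :
    (shiftTwo A ^ m) t = aeval (shiftZigzag A) ((4 * X - 1 : ℤ[X]) ^ m) t := by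
  have hcomm : Commute (shiftTwo A) (aeval (shiftZigzag A) (4 * X - 1 : ℤ[X])) := by
    rw [aeval_four_mul_X_sub_one]
    exact (shiftTwo_comm_shiftZigzag.smul_right _).sub_right (Commute.one_right _)
  induction m with
  | zero => simp
  | succ m ih =>
    rw [pow_succ, Module.End.mul_apply, shiftTwo_eq ht, ← Module.End.mul_apply,
      (hcomm.pow_left m).eq, Module.End.mul_apply, ih, ← Module.End.mul_apply, ← map_mul,
      pow_succ']

/-- Since 4 B t = S t, a multiple killing t (2k+1), respectively t (2k), kills t (2k+2),
respectively t (2k+1) - t (2k+3), after one more factor 4. The start is t 0 = t 1 = 0. -/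
theorem four_pow_smul_eq_zero {t : ℕ → ℤ → A} (h0 : t 0 = 0) (h1 : t 1 = 0)
    (ht : ∀ i, neighborSum A (t i) = (4 : ℤ) • zigzag (ℤ → A) t i) (i : ℕ) :
    (4 : ℤ) ^ (i / 2) • t i = 0 := by
  have key : ∀ k, (4 : ℤ) ^ k • t (2 * k) = 0 ∧ (4 : ℤ) ^ k • t (2 * k + 1) = 0 := by
    intro k
    induction k with
    | zero => simp [h0, h1]
    | succ k ih =>
      have e := ht (2 * k)
      have o := ht (2 * k + 1)
      rw [zigzag_even] at e
      rw [zigzag_odd] at o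
      refine ⟨?_, ?_⟩
      · rw [pow_succ, mul_smul, ← o, ← map_zsmul, ih.2, map_zero]
      · have : (4 : ℤ) ^ (k + 1) • (t (2 * k + 1) - t (2 * (k + 1) + 1)) = 0 := by
          rw [pow_succ, mul_smul, ← e, ← map_zsmul, ih.1, map_zero]
        rw [smul_sub, pow_succ', mul_smul, ih.2, smul_zero, zero_sub, neg_eq_zero] at this
        rwa [pow_succ']
  obtain ⟨k, rfl | rfl⟩ := Nat.even_or_odd' i
  · simpa using (key k).1
  · rw [show (2 * k + 1) / 2 = k by omega]
    exact (key k).2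

theorem two_pow_smul_eq_zero {t : ℕ → ℤ → A} (h0 : t 0 = 0) (h1 : t 1 = 0) {n : ℕ}
    (hn : ∀ i, n + 1 < i → t i = 0)
    (ht : ∀ i, neighborSum A (t i) = (4 : ℤ) • zigzag (ℤ → A) t i) :
    (2 : ℤ) ^ (2 * (n + 1)) • t = 0 := by
  ext1 i
  by_cases hi : n + 1 < i
  · simp [hn i hi]
  · rw [Pi.smul_apply, pow_mul, ← Nat.sub_add_cancel (show i / 2 ≤ n + 1 by omega), pow_add,
      mul_smul]
    norm_num [four_pow_smul_eq_zero h0 h1 ht i]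

theorem periodic_iff_sub_one_eq_zero {t : ℕ → ℤ → A}
    (ht : ∀ i, neighborSum A (t i) = (4 : ℤ) • zigzag (ℤ → A) t i) (m : ℕ) :
    (∀ i x, t i (x + 2 * m) = t i x) ↔
      aeval (shiftZigzag A) ((4 * X - 1 : ℤ[X]) ^ m - 1) t = 0 := by
  rw [map_sub, LinearMap.sub_apply, ← shiftTwo_pow_eq ht, map_one, Module.End.one_apply,
    sub_eq_zero]
  simp_rw [funext_iff, shiftTwo_pow_apply]

theorem aeval_one_add_two_mul_mul_eq_zero_iff {V : Type*} [AddCommGroup V] {C : Module.End ℤ V}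
    {v : V} {K : ℕ} (hv : (2 : ℤ) ^ K • v = 0) (P E : ℤ[X]) :
    aeval C (P * (1 + 2 * E)) v = 0 ↔ aeval C P v = 0 := by
  rw [mul_comm, map_mul, Module.End.mul_apply]
  refine ⟨fun h => eq_zero_of_one_add_two_mul (K := K) (E := aeval C E) ?_ ?_,
    fun h => by rw [h, map_zero]⟩
  · rw [← map_smul, hv, map_zero]
  · rw [← h, map_add, map_mul, map_one, map_ofNat]

theorem periodic_iff_of_odd {t : ℕ → ℤ → A} (h0 : t 0 = 0) (h1 : t 1 = 0) {n : ℕ}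
    (hn : ∀ i, n + 1 < i → t i = 0)
    (ht : ∀ i, neighborSum A (t i) = (4 : ℤ) • zigzag (ℤ → A) t i) {m : ℕ} (hm : Odd m) :
    (∀ i x, t i (x + 2 * m) = t i x) ↔ (2 : ℤ) • t = 0 := by
  obtain ⟨E, hE⟩ := odd_case_polynomial hm
  rw [periodic_iff_sub_one_eq_zero ht, hE,
    aeval_one_add_two_mul_mul_eq_zero_iff (two_pow_smul_eq_zero h0 h1 hn ht),
    show (2 : ℤ[X]) = C 2 by rfl, aeval_C, Module.algebraMap_end_apply]

/-- B loses no information when t 0 = t 1 = 0: its odd entries are the t (2k+2), and its even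
entries are successive differences of the odd terms of t. -/
theorem smul_zigzag_eq_zero_iff {F : Type*} [AddCommGroup F] {t : ℕ → F} (h0 : t 0 = 0)
    (h1 : t 1 = 0) (e : ℤ) : e • zigzag F t = 0 ↔ e • t = 0 := by
  refine ⟨fun h => ?_, fun h => by rw [← map_zsmul, h, map_zero]⟩
  have h' : ∀ i, e • zigzag F t i = 0 := fun i => congrFun h i
  ext i
  rw [Pi.smul_apply, Pi.zero_apply]
  obtain ⟨k, rfl | rfl⟩ := Nat.even_or_odd' i
  · cases k with
    | zero => simp [h0]
    | succ k => rw [← zigzag_odd t, h']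
  · induction k with
    | zero => simp [h1]
    | succ k ih =>
      have := h' (2 * k)
      rwa [zigzag_even, smul_sub, ih, zero_sub, neg_eq_zero] at this

theorem smul_shiftZigzag_eq_zero_iff {t : ℕ → ℤ → A} (h0 : t 0 = 0) (h1 : t 1 = 0) (e : ℤ) :
    e • shiftZigzag A t = 0 ↔ e • t = 0 := by
  rw [← smul_zigzag_eq_zero_iff h0 h1]
  refine ⟨fun h => ?_, fun h => ?_⟩
  · ext i x
    simpa [shiftZigzag] using congrFun (congrFun h i) (x - 1)
  · ext i x
    exact congrFun (congrFun h i) (x + 1)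

theorem odd_smul_eq_zero_iff {V : Type*} [AddCommGroup V] {v : V} {K r : ℕ}
    (hv : (2 : ℤ) ^ K • v = 0) (hr : Odd r) : (r : ℤ) • v = 0 ↔ v = 0 := by
  refine ⟨fun h => ?_, fun h => by rw [h, smul_zero]⟩
  have hc : IsCoprime ((2 : ℤ) ^ K) r := by
    refine IsCoprime.pow_left ?_
    exact_mod_cast Nat.isCoprime_iff_coprime.2 (Nat.coprime_two_left.2 hr)
  obtain ⟨a, b, hab⟩ := hc
  rw [← one_smul ℤ v, ← hab, add_smul, mul_smul, mul_smul, hv, h, smul_zero, smul_zero, add_zero]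

theorem periodic_iff_of_even {t : ℕ → ℤ → A} (h0 : t 0 = 0) (h1 : t 1 = 0) {n : ℕ}
    (hn : ∀ i, n + 1 < i → t i = 0)
    (ht : ∀ i, neighborSum A (t i) = (4 : ℤ) • zigzag (ℤ → A) t i) {m : ℕ} (hm0 : m ≠ 0)
    (hm : Even m) :
    (∀ i x, t i (x + 2 * m) = t i x) ↔ ((4 * m : ℕ) : ℤ) • t = 0 := by
  obtain ⟨s, r, hr, rfl⟩ := Nat.exists_eq_two_pow_mul_odd hm0
  obtain _ | s := s
  · rw [pow_zero, one_mul] at hm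
    exact absurd hm (Nat.not_even_iff_odd.2 hr)
  have hK := two_pow_smul_eq_zero h0 h1 hn ht
  obtain ⟨E, hE⟩ := even_case_polynomial hr s
  rw [periodic_iff_sub_one_eq_zero ht, hE, ← mul_assoc,
    aeval_one_add_two_mul_mul_eq_zero_iff hK,
    show (2 : ℤ[X]) ^ (s + 3) = C (2 ^ (s + 3)) by simp, map_mul, aeval_C, aeval_X,
    Module.End.mul_apply, Module.algebraMap_end_apply, smul_shiftZigzag_eq_zero_iff h0 h1,
    show ((4 * (2 ^ (s + 1) * r) : ℕ) : ℤ) = r * 2 ^ (s + 3) by push_cast; ring, mul_smul,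
    odd_smul_eq_zero_iff (K := 2 * (n + 1)) _ hr]
  rw [smul_comm, hK, smul_zero]

end Periodicity

/-! ### Lifting functions from the graph to ℕ × ℤ -/

/-- Functions on `ℤ` vanishing at all `x` with `x + j` even. -/
def paritySubgroup (A : Type*) [AddCommGroup A] (j : ℕ) : AddSubgroup (ℤ → A) where
  carrier := {f | ∀ x : ℤ, Even (x + j) → f x = 0}
  zero_mem' := fun _ _ => rfl
  add_mem' hf hg x hx := by simp [hf x hx, hg x hx]
  neg_mem' hf x hx := by simp [hf x hx]

/-- Functions on `ℤ` with period `p`. -/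
def periodicSubgroup (A : Type*) [AddCommGroup A] (p : ℤ) : AddSubgroup (ℤ → A) where
  carrier := {f | Function.Periodic f p}
  zero_mem' := fun _ => rfl
  add_mem' hf hg := hf.add hg
  neg_mem' hf x := by simp [hf x]

theorem paritySubgroup_add_two (A : Type*) [AddCommGroup A] (j : ℕ) :
    paritySubgroup A (j + 2) = paritySubgroup A j := by
  ext f
  refine forall_congr' fun x => ?_
  rw [Nat.cast_add, ← add_assoc, Nat.cast_two, Int.even_add, iff_true_right even_two]

namespace CLFVertex

variable {m n : ℕ}

theorem castHom_intCast_add_eq_zero_iff (x : ℤ) (y : ℕ) :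
    ZMod.castHom (dvd_mul_right 2 m) (ZMod 2) (x : ZMod (2 * m)) + (y : ZMod 2) = 0 ↔
      Even (x + y) := by
  rw [map_intCast, even_iff_two_dvd, ← Int.cast_natCast, ← Int.cast_add]
  exact ZMod.intCast_zmod_eq_zero_iff_dvd _ 2

/-- The vertex `(x mod 2m, y)`. -/
def mk (x : ℤ) (y : ℕ) (h : y < n + 2 ∧ Even (x + y)) : CLFVertex m n :=
  ⟨((x : ZMod (2 * m)), ⟨y, h.1⟩), (castHom_intCast_add_eq_zero_iff x y).2 h.2⟩

variable {A : Type*} [AddCommGroup A]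

/-- The lift to `ℕ × ℤ`, extended by zero, of a function on the vertices. -/
def lift (u : CLFVertex m n → A) (y : ℕ) (x : ℤ) : A :=
  if h : y < n + 2 ∧ Even (x + y) then u (mk x y h) else 0

theorem exists_eq_mk [NeZero m] (p : CLFVertex m n) : ∃ x y h, p = mk x y h := by
  obtain ⟨⟨x, y, hy⟩, hp⟩ := p
  obtain ⟨x, rfl⟩ := ZMod.intCast_surjective x
  exact ⟨x, y, ⟨hy, (castHom_intCast_add_eq_zero_iff x y).1 hp⟩, rfl⟩

theorem sum_ite_eq_lift [NeZero m] (u : CLFVertex m n → A) (y : ℕ) (x : ℤ) :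
    (∑ q : CLFVertex m n, if q.1.1 = x ∧ (q.1.2 : ℕ) = y then u q else 0) = lift u y x := by
  by_cases h : y < n + 2 ∧ Even (x + y)
  · rw [lift, dif_pos h, Finset.sum_eq_single (mk x y h)]
    · rw [if_pos ⟨rfl, rfl⟩]
    · intro q _ hq
      refine if_neg fun h' => hq ?_
      exact Subtype.ext (Prod.ext h'.1 (Fin.ext h'.2))
    · simp
  · rw [lift, dif_neg h]
    refine Finset.sum_eq_zero fun q _ => if_neg ?_
    rintro ⟨h1, h2⟩
    refine h ⟨h2 ▸ q.1.2.2, ?_⟩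
    rw [← castHom_intCast_add_eq_zero_iff (m := m), ← h1, ← h2]
    exact q.2

/-- The lift of `u` to the row below `y`. -/
def liftBelow (u : CLFVertex m n → A) (y : ℕ) : ℤ → A :=
  -- Truncated subtraction would make row 0 its own lower neighbour.
  if y = 0 then 0 else lift u (y - 1)

theorem sum_step_eq [NeZero m] (u : CLFVertex m n → A) (x : ℤ) (y : ℕ) :
    (∑ q : CLFVertex m n, if q.1.1 = (x : ZMod (2 * m)) ∧
      ((q.1.2 : ℕ) = y + 1 ∨ y = (q.1.2 : ℕ) + 1) then u q else 0) =
      lift u (y + 1) x + liftBelow u y x := by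
  have hb : (∑ q : CLFVertex m n, if q.1.1 = (x : ZMod (2 * m)) ∧ y = (q.1.2 : ℕ) + 1
      then u q else 0) = liftBelow u y x := by
    cases y with
    | zero => simp [liftBelow]
    | succ y =>
      rw [liftBelow, if_neg y.succ_ne_zero, Nat.add_sub_cancel, ← sum_ite_eq_lift]
      exact Finset.sum_congr rfl fun q _ => if_congr (and_congr_right' (by omega)) rfl rfl
  rw [← sum_ite_eq_lift, ← hb, ← Finset.sum_add_distrib]
  refine Finset.sum_congr rfl fun q _ => ?_
  have h : ¬ ((q.1.2 : ℕ) = y + 1 ∧ y = (q.1.2 : ℕ) + 1) := by omega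
  split_ifs <;> first | (exfalso; tauto) | simp

end CLFVertex

open CLFVertex

theorem mem_star_CLF' {m n : ℕ} [NeZero m] {p : CLFVertex m n} {e : CLFEdge m n} :
    e ∈ (CLF' m n).star p ↔ e.1.1 = p :=
  Set.Finite.mem_toFinset _

/-- The Boolean label separates the edges towards x+1 from those towards x-1, so both are counted
even when m = 1 and the two endpoints coincide. -/
theorem sum_star_CLF' {m n : ℕ} [NeZero m] {A : Type} [AddCommGroup A] (u : CLFVertex m n → A)
    (x : ℤ) (y : ℕ) (h : y < n + 2 ∧ Even (x + y)) :
    ∑ e ∈ (CLF' m n).star (mk x y h), u ((CLF' m n).tgt e) =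
      lift u (y + 1) (x + 1) + liftBelow u y (x + 1) +
        (lift u (y + 1) (x - 1) + liftBelow u y (x - 1)) := by
  classical
  set p : CLFVertex m n := mk x y h with hp
  have key : ∑ e ∈ (CLF' m n).star p, u ((CLF' m n).tgt e) =
      ∑ t : CLFVertex m n × Bool,
        if (if t.2 = true then CLFStep p t.1 else CLFStep t.1 p) then u t.1 else 0 := by
    rw [← Finset.sum_filter]
    refine Finset.sum_bij' (fun e _ => (e.1.2.1, e.1.2.2))
      (fun t ht => ⟨(p, t.1, t.2), (Finset.mem_filter.1 ht).2⟩) ?_ ?_ ?_ ?_ ?_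
    · rintro ⟨⟨p', q, b⟩, he⟩ h'
      have : p' = p := mem_star_CLF'.1 h'
      subst this
      simpa using he
    · intro t ht
      exact mem_star_CLF'.2 rfl
    · rintro ⟨⟨p', q, b⟩, he⟩ h'
      have : p' = p := mem_star_CLF'.1 h'
      subst this
      rfl
    · intro t ht
      rfl
    · intro e he
      rfl
  rw [key, Fintype.sum_prod_type_right, Fintype.sum_bool, ← sum_step_eq, ← sum_step_eq]
  congr 1
  · refine Finset.sum_congr rfl fun q _ => ?_
    simp [CLFStep, hp, mk]
  · refine Finset.sum_congr rfl fun q _ => ?_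
    simp [CLFStep, hp, mk, eq_sub_iff_add_eq, or_comm, eq_comm]

section

variable {m n : ℕ} {A : Type} [AddCommGroup A] {u : CLFVertex m n → A}

theorem lift_mem_paritySubgroup (y : ℕ) : lift u y ∈ paritySubgroup A (y + 1) := by
  intro x hx
  refine dif_neg fun h => ?_
  rw [Nat.cast_add, ← add_assoc, Nat.cast_one] at hx
  exact Int.not_even_iff_odd.2 h.2.add_one hx

theorem lift_periodic (y : ℕ) : lift u y ∈ periodicSubgroup A (2 * m) := by
  intro x
  have h1 : ((x + 2 * m : ℤ) : ZMod (2 * m)) = x := by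
    have : ((2 * m : ℕ) : ZMod (2 * m)) = 0 := ZMod.natCast_self _
    push_cast at this ⊢
    rw [this, add_zero]
  have h2 : Even (x + 2 * m + y) ↔ Even (x + y) := by
    simp [parity_simps]
  by_cases h : y < n + 2 ∧ Even (x + y)
  · rw [lift, lift, dif_pos h, dif_pos ⟨h.1, h2.2 h.2⟩]
    simp only [mk, h1]
  · rw [lift, lift, dif_neg h, dif_neg fun h' => h ⟨h'.1, h2.1 h'.2⟩]

theorem lift_of_lt {y : ℕ} (hy : n + 1 < y) : lift u y = 0 :=
  funext fun _ => dif_neg fun h => by omega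

variable [NeZero m]

theorem lift_injective : Function.Injective (lift : (CLFVertex m n → A) → ℕ → ℤ → A) := by
  intro u v huv
  ext p
  obtain ⟨x, y, h, rfl⟩ := exists_eq_mk p
  simpa [lift, h] using congrFun (congrFun huv y) x

theorem forall_bdry_iff :
    (∀ p ∈ (CLF' m n).bdry, u p = 0) ↔ lift u 0 = 0 ∧ lift u (n + 1) = 0 := by
  refine ⟨fun hu => ⟨?_, ?_⟩, fun hu p hp => ?_⟩
  · ext x
    unfold lift
    split_ifs
    exacts [hu _ (Or.inl rfl), rfl]
  · ext x
    unfold lift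
    split_ifs
    exacts [hu _ (Or.inr rfl), rfl]
  · obtain ⟨x, y, h, rfl⟩ := exists_eq_mk p
    rw [← show lift u y x = u (mk x y h) from dif_pos h]
    obtain hp | hp := hp
    · rw [show y = 0 from hp, hu.1]; rfl
    · rw [show y = n + 1 from hp, hu.2]; rfl

/-- The coefficient 4 is the degree of an interior vertex. Boundary vertices have fewer edges, but
there u = 0. -/
theorem laplacian_CLF'_apply (hu : ∀ p ∈ (CLF' m n).bdry, u p = 0) (x : ℤ) (y : ℕ)
    (h : y < n + 2 ∧ Even (x + y)) :
    (stdNetwork (CLF' m n)).laplacian A u (mk x y h) = (4 : ℤ) • lift u y x -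
      (neighborSum A (lift u (y + 1)) x + neighborSum A (liftBelow u y) x) := by
  have e1 : (stdNetwork (CLF' m n)).laplacian A u (mk x y h) =
      ∑ e ∈ (CLF' m n).star (mk x y h), (u (mk x y h) - u ((CLF' m n).tgt e)) := by
    change (0 : ℤ) • u _ + ∑ e ∈ (CLF' m n).star (mk x y h), (1 : ℤ) • (u _ - u _) = _
    simp only [zero_smul, zero_add, one_smul]
    rfl
  -- The neighbour sum of a constant function computes the degree.
  have e2 := sum_star_CLF' (fun _ : CLFVertex m n => u (mk x y h)) x y h
  have e3 : ∑ e ∈ (CLF' m n).star (mk x y h), u (mk x y h) = (4 : ℤ) • u (mk x y h) := by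
    by_cases hb : y = 0 ∨ y = n + 1
    · rw [hu (mk x y h) hb]; simp
    · rw [e2]
      obtain _ | y := y
      · simp at hb
      · have h1 : y + 1 + 1 < n + 2 := by omega
        have h2 : y < n + 2 := by omega
        have h0 := Int.even_iff.1 h.2
        push_cast at h0
        have h4 : Even (x + 1 + (y + 1 + 1 : ℕ)) := by rw [Int.even_iff]; push_cast; omega
        have h5 : Even (x - 1 + (y + 1 + 1 : ℕ)) := by rw [Int.even_iff]; push_cast; omega
        have h6 : Even (x + 1 + y) := by rw [Int.even_iff]; omega
        have h7 : Even (x - 1 + y) := by rw [Int.even_iff]; omega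
        simp only [lift, liftBelow, h1, h2, h4, h5, h6, h7, dif_pos, and_self,
          y.succ_ne_zero, if_false, Nat.add_sub_cancel]
        module
  rw [e1, Finset.sum_sub_distrib, e3, sum_star_CLF', show lift u y x = u (mk x y h) from dif_pos h]
  congr 1
  simp only [neighborSum, AddMonoidHom.coe_mk, ZeroHom.coe_mk]
  abel

/-- The Laplacian at y = 0 gives S (a 1) = 0, and the rows 1, …, n+1 give the recurrence. At points
of the wrong parity, and above the top row, all terms vanish. -/
theorem mem_U₀_iff : u ∈ (stdNetwork (CLF' m n)).U₀ A ↔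
    lift u ∈ harmonicSeq (neighborSum A)
      (fun j => paritySubgroup A j ⊓ periodicSubgroup A (2 * m)) n := by
  have hpar : ∀ {y : ℕ} {x : ℤ}, ¬ Even (x + y) → lift u y x = 0 := fun {y x} h =>
    dif_neg fun h' => h h'.2
  have e0 : ∀ x : ℤ, ∀ y : ℕ, ¬ Even (x + y) → ¬ Even (x + 1 + (y + 1 : ℕ)) ∧
      ¬ Even (x - 1 + (y + 1 : ℕ)) := fun x y h => by
    simp only [Int.even_iff] at h ⊢; constructor <;> · push_cast; omega
  constructor
  · rintro ⟨-, hL, hb⟩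
    have hL' : ∀ (x : ℤ) (y : ℕ), y < n + 2 ∧ Even (x + y) → (4 : ℤ) • lift u y x =
        neighborSum A (lift u (y + 1)) x + neighborSum A (liftBelow u y) x := fun x y h => by
      rw [← sub_eq_zero, ← laplacian_CLF'_apply hb x y h, hL]; rfl
    have hb' := forall_bdry_iff.1 hb
    have hn : ∀ y, n < y → lift u y = 0 := fun y hy => by
      obtain rfl | hy := (Nat.succ_le_of_lt hy).eq_or_lt
      exacts [hb'.2, lift_of_lt hy]
    refine ⟨hb'.1, hn, fun y => ⟨lift_mem_paritySubgroup y, lift_periodic y⟩, ?_, fun y => ?_⟩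
    · ext x
      by_cases hx : Even x
      · have := hL' x 0 ⟨by omega, by simpa using hx⟩
        simpa [liftBelow, hb'.1] using this.symm
      · have h1 := e0 x 0 (by simpa using hx)
        change lift u (0 + 1) (x + 1) + lift u (0 + 1) (x - 1) = 0
        rw [hpar h1.1, hpar h1.2, add_zero]
    · ext x
      by_cases hy : n < y
      · rw [hn _ hy, hn (y + 1) (by omega), hn (y + 2) (by omega)]
        simp
      by_cases hx : Even (x + (y + 1 : ℕ))
      · have := hL' x (y + 1) ⟨by omega, hx⟩
        rw [map_add, Pi.add_apply, Pi.smul_apply, this]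
        rfl
      · have h1 := e0 x (y + 1) hx
        change lift u (y + 1 + 1) (x + 1) + lift u y (x + 1) +
          (lift u (y + 1 + 1) (x - 1) + lift u y (x - 1)) = (4 : ℤ) • lift u (y + 1) x
        have h2 : ¬ Even (x + 1 + y) := by simp only [Int.even_iff] at hx ⊢; push_cast at hx; omega
        have h3 : ¬ Even (x - 1 + y) := by simp only [Int.even_iff] at hx ⊢; push_cast at hx; omega
        rw [hpar h1.1, hpar h1.2, hpar h2, hpar h3, hpar hx]
        simp
  · rintro ⟨h0, hn, -, h1, hS⟩
    have hb : ∀ p ∈ (CLF' m n).bdry, u p = 0 := forall_bdry_iff.2 ⟨h0, hn _ (by omega)⟩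
    refine ⟨Set.toFinite (α := CLFVertex m n) _, funext fun p => ?_, hb⟩
    obtain ⟨x, y, h, rfl⟩ := exists_eq_mk p
    rw [laplacian_CLF'_apply hb]
    change _ = (0 : A)
    obtain _ | y := y
    · simp [h0, h1, liftBelow]
    · rw [sub_eq_zero, ← Pi.add_apply, ← map_add]
      exact (congrFun (hS y) x).symm

/-- The lift of harmonic functions from the graph to `ℕ × ℤ`. -/
noncomputable def U₀EquivHarmonicSeq (m n : ℕ) [NeZero m] (A : Type) [AddCommGroup A] :
    (stdNetwork (CLF' m n)).U₀ A ≃+ harmonicSeq (neighborSum A)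
      (fun j => paritySubgroup A j ⊓ periodicSubgroup A (2 * m)) n :=
  AddEquiv.ofBijective (AddMonoidHom.mk'
    (fun u => (⟨lift u.1, mem_U₀_iff.1 u.2⟩ : harmonicSeq (neighborSum A)
      (fun j => paritySubgroup A j ⊓ periodicSubgroup A (2 * m)) n))
    fun u v => by
      ext y x
      by_cases h : y < n + 2 ∧ Even (x + y) <;> simp only [lift, h, dif_neg, not_false_eq_true, AddSubgroup.coe_add,
        Pi.add_apply, add_zero]
      · rfl)
    ⟨fun u v huv => Subtype.ext (lift_injective (congrArg Subtype.val huv)), by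
      rintro ⟨a, ha⟩
      have hlift : lift (fun p : CLFVertex m n => a p.1.2 p.1.1.val) = a := by
        obtain ⟨-, h2, h3, -⟩ := ha
        ext y x
        by_cases h : y < n + 2 ∧ Even (x + y)
        · rw [lift, dif_pos h]
          simp only [mk, ZMod.val_intCast]
          have hp : Function.Periodic (a y) (2 * m) := (h3 y).2
          have := hp.sub_zsmul_eq (x := x) (x / (2 * m))
          rw [Nat.cast_mul, Nat.cast_two, Int.emod_def, mul_comm, ← smul_eq_mul (x / _)]
          exact this
        · rw [lift, dif_neg h]
          by_cases hy : y < n + 2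
          · refine ((h3 y).1 x ?_).symm
            rw [Nat.cast_add, ← add_assoc, Nat.cast_one]
            exact (Int.not_even_iff_odd.1 fun h' => h ⟨hy, h'⟩).add_one
          · rw [h2 y (by omega)]; rfl
      exact ⟨⟨fun p : CLFVertex m n => a p.1.2 p.1.1.val, mem_U₀_iff.2 (hlift.symm ▸ ha)⟩,
        Subtype.ext hlift⟩⟩

end

/-! ### Zigzag sequences from their values at 0 and 1 -/

/-- Chebyshev polynomials S_k, indexed by ℤ, obey this recurrence; S_(x-1) - S_(x-2) equals 1 at
both x = 0 and x = 1. A single initial vector suffices because parity later keeps only one of the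
two values for each i. -/
theorem exists_int_recurrence {H : Type*} [AddCommGroup H] (D : Module.End ℤ H) (h : H) :
    ∃ f : ℤ → H, f 0 = h ∧ f 1 = h ∧ ∀ x, f (x + 1) + f (x - 1) = D (f x) := by
  refine ⟨fun x => aeval D (Chebyshev.S ℤ (x - 1) - Chebyshev.S ℤ (x - 2)) h, ?_, ?_,
    fun x => ?_⟩
  · simp [Chebyshev.S_neg_one, Chebyshev.S_neg_two]
  · simp [show (1 : ℤ) - 2 = -1 by rfl, Chebyshev.S_neg_one]
  · rw [← Module.End.mul_apply, ← LinearMap.add_apply, ← map_add]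
    nth_rw 2 [← aeval_X (R := ℤ) D]
    rw [← map_mul]
    congr 2
    have e1 := Chebyshev.S_add_one ℤ (x - 1)
    have e2 := Chebyshev.S_add_one ℤ (x - 2)
    rw [show x - 1 + 1 = x by ring, show x - 1 - 1 = x - 2 by ring] at e1
    rw [show x - 2 + 1 = x - 1 by ring, show x - 2 - 1 = x - 1 - 2 by ring] at e2
    rw [show x + 1 - 1 = x by ring, show x + 1 - 2 = x - 1 by ring,
      show x - 1 - 1 = x - 2 by ring, e1]
    linear_combination -e2

section Evaluation

variable {A : Type*} [AddCommGroup A]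

theorem gcd_zsmul_eq_zero_iff {a b : ℕ} {v : A} :
    ((Nat.gcd a b : ℕ) : ℤ) • v = 0 ↔ (a : ℤ) • v = 0 ∧ (b : ℤ) • v = 0 := by
  simp only [natCast_zsmul, ← addOrderOf_dvd_iff_nsmul_eq_zero, Nat.dvd_gcd_iff]

/-- Non-periodic zigzag sequences killed by `d`. -/
def torsionZigzagSeq (A : Type*) [AddCommGroup A] (n d : ℕ) : AddSubgroup (ℕ → ℤ → A) :=
  zigzagSeq (neighborSum A) (paritySubgroup A) n ⊓ AddSubgroup.torsionBy _ (d : ℤ)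

theorem mem_zigzagSeq_inf_periodic_iff {n m d : ℕ}
    (h : ∀ t ∈ zigzagSeq (neighborSum A) (paritySubgroup A) n,
      (∀ i x, t i (x + 2 * m) = t i x) ↔ (d : ℤ) • t = 0) :
    zigzagSeq (neighborSum A) (fun j => paritySubgroup A j ⊓ periodicSubgroup A (2 * m)) n =
      torsionZigzagSeq A n d := by
  ext t
  refine ⟨fun ht => ?_, fun ht => ?_⟩
  · obtain ⟨h0, h1, h2, h3, h4⟩ := ht
    have ht : t ∈ zigzagSeq (neighborSum A) (paritySubgroup A) n :=
      ⟨h0, h1, h2, fun i => (h3 i).1, h4⟩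
    exact ⟨ht, (h t ht).1 fun i x => (h3 i).2 x⟩
  · obtain ⟨ht, hd⟩ := ht
    have hp := (h t ht).2 hd
    obtain ⟨h0, h1, h2, h3, h4⟩ := ht
    exact ⟨h0, h1, h2, fun i => ⟨h3 i, hp i⟩, h4⟩

/-- Evaluation of a zigzag sequence at the points of `{0, 1}` of the right parity. -/
def torsionZigzagSeq.eval (A : Type*) [AddCommGroup A] (n d : ℕ) : torsionZigzagSeq A n d →+
    (∀ i : Fin n, AddSubgroup.torsionBy A ((Nat.gcd (4 ^ (i.val / 2 + 1)) d : ℕ) : ℤ)) where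
  toFun t i := ⟨t.1 (i + 2) (if Even i.val then 1 else 0), by
    obtain ⟨t, ⟨h0, h1, h2, h3, h4⟩, hd⟩ := t
    refine gcd_zsmul_eq_zero_iff.2 ⟨?_, congrFun (congrFun hd _) _⟩
    have := four_pow_smul_eq_zero h0 h1 h4 (i + 2)
    rw [show (i.val + 2) / 2 = i.val / 2 + 1 by omega] at this
    exact_mod_cast congrFun this _⟩
  map_zero' := rfl
  map_add' _ _ := rfl

theorem torsionZigzagSeq.eval_injective (n d : ℕ) :
    Function.Injective (torsionZigzagSeq.eval A n d) := by
  rw [injective_iff_map_eq_zero]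
  rintro ⟨t, ⟨h0, h1, h2, h3, h4⟩, hd⟩ ht
  have ht' : ∀ i, i < n → t (i + 2) (if Even i then 1 else 0) = 0 := fun i hi =>
    congrArg Subtype.val (congrFun ht ⟨i, hi⟩)
  have hbase : ∀ i, t i 0 = 0 ∧ t i 1 = 0 := by
    intro i
    obtain _ | _ | i := i
    · simp [h0]
    · simp [h1]
    by_cases hi : i < n
    · have := ht' i hi
      by_cases hi' : Even i
      · rw [if_pos hi'] at this
        exact ⟨h3 _ 0 (by simpa [parity_simps] using hi'), this⟩
      · rw [if_neg hi'] at this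
        exact ⟨this, h3 _ 1 (by simpa [parity_simps] using hi')⟩
    · rw [h2 _ (by omega)]; simp
  have hstep : ∀ i x, t i (x + 1) + t i (x - 1) = (4 : ℤ) • zigzag (ℤ → A) t i x := fun i x =>
    congrFun (h4 i) x
  have hz : ∀ x, (∀ i, t i x = 0) → ∀ i, zigzag (ℤ → A) t i x = 0 := fun x hx i => by
    by_cases hi : Even i <;> simp [zigzag, hi, hx]
  have key : ∀ x : ℤ, (∀ i, t i x = 0) ∧ ∀ i, t i (x + 1) = 0 := by
    intro x
    induction x using Int.induction_on with
    | zero => exact ⟨fun i => (hbase i).1, fun i => by simpa using (hbase i).2⟩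
    | succ x ih =>
      refine ⟨ih.2, fun i => ?_⟩
      have := hstep i (x + 1)
      rwa [hz _ ih.2, smul_zero, add_sub_cancel_right, ih.1, add_zero] at this
    | pred x ih =>
      refine ⟨fun i => ?_, fun i => by simpa using ih.1 i⟩
      have := hstep i (-x)
      rwa [hz _ ih.1, smul_zero, ih.2, zero_add] at this
  exact Subtype.ext (funext fun i => funext fun x => (key x).1 i)

/-- The sequences of possible values of zigzag sequences. -/
def zigzagValues (A : Type*) [AddCommGroup A] (n d : ℕ) : Submodule ℤ (ℕ → A) where
  carrier := {h | (∀ i, n + 1 < i → h i = 0) ∧ (∀ i, (4 : ℤ) ^ (i / 2) • h i = 0) ∧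
    (d : ℤ) • h = 0}
  zero_mem' := by simp
  add_mem' := by
    rintro a b ⟨h1, h2, h3⟩ ⟨k1, k2, k3⟩
    exact ⟨fun i hi => by simp [h1 i hi, k1 i hi], fun i => by simp [h2, k2], by simp [h3, k3]⟩
  smul_mem' := by
    rintro c a ⟨h1, h2, h3⟩
    exact ⟨fun i hi => by simp [h1 i hi], fun i => by rw [Pi.smul_apply, smul_comm, h2, smul_zero],
      by rw [smul_comm, h3, smul_zero]⟩

/-- The operator `4 B`, where `B` is the operator `zigzag`. -/
def fourZigzag (A : Type*) [AddCommGroup A] : Module.End ℤ (ℕ → A) :=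
  (4 : ℤ) • (zigzag A).toIntLinearMap

/-- The factor 4 pays for B raising the index: each entry involved has torsion exponent at most
4^(i/2 + 1). So the recurrence can be run inside `zigzagValues`. -/
theorem fourZigzag_mem {n d : ℕ} {h : ℕ → A} (hh : h ∈ zigzagValues A n d) :
    fourZigzag A h ∈ zigzagValues A n d := by
  obtain ⟨h1, h2, h3⟩ := hh
  have h2' : ∀ k, (4 : ℤ) ^ k • h (2 * k) = 0 ∧ (4 : ℤ) ^ k • h (2 * k + 1) = 0 := fun k => by
    refine ⟨?_, ?_⟩
    · simpa using h2 (2 * k)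
    · have := h2 (2 * k + 1)
      rwa [show (2 * k + 1) / 2 = k by omega] at this
  refine ⟨fun i hi => ?_, fun i => ?_, ?_⟩
  · change (4 : ℤ) • zigzag A h i = 0
    simp [zigzag, h1 (i + 1) (by omega), h1 (i + 3) (by omega)]
  · change (4 : ℤ) ^ (i / 2) • (4 : ℤ) • zigzag A h i = 0
    rw [smul_smul, ← pow_succ]
    obtain ⟨k, rfl | rfl⟩ := Nat.even_or_odd' i
    · rw [zigzag_even, show 2 * k / 2 = k by omega, smul_sub, (h2' (k + 1)).2, pow_succ', mul_smul,
        (h2' k).2, smul_zero, sub_zero]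
    · rw [zigzag_odd, show (2 * k + 1) / 2 = k by omega, (h2' (k + 1)).1]
  · rw [← map_zsmul, h3, map_zero]

theorem torsionZigzagSeq.eval_surjective (n d : ℕ) :
    Function.Surjective (torsionZigzagSeq.eval A n d) := by
  intro τ
  let h : ℕ → A := fun i => if hi : 2 ≤ i ∧ i - 2 < n then τ ⟨i - 2, hi.2⟩ else 0
  have hτ : ∀ i, (4 : ℤ) ^ (i.val / 2 + 1) • (τ i : A) = 0 ∧ (d : ℤ) • (τ i : A) = 0 := fun i =>
    by simpa using gcd_zsmul_eq_zero_iff.1 (τ i).2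
  have hh : h ∈ zigzagValues A n d := by
    refine ⟨fun i hi => dif_neg (by omega), fun i => ?_, funext fun i => ?_⟩
    · by_cases hi : 2 ≤ i ∧ i - 2 < n
      · simp only [h, dif_pos hi]
        have := (hτ ⟨i - 2, hi.2⟩).1
        rwa [show i / 2 = (i - 2) / 2 + 1 by omega]
      · simp [h, dif_neg hi]
    · by_cases hi : 2 ≤ i ∧ i - 2 < n
      · simp only [h, dif_pos hi, Pi.smul_apply]
        exact (hτ _).2
      · simp [h, dif_neg hi]
  obtain ⟨f, hf0, hf1, hf⟩ := exists_int_recurrence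
    ((fourZigzag A).restrict fun _ => fourZigzag_mem (n := n) (d := d)) ⟨h, hh⟩
  have hf' : ∀ x i, (f (x + 1)).1 i + (f (x - 1)).1 i = (4 : ℤ) • zigzag A (f x).1 i := fun x i =>
    congrFun (congrArg Subtype.val (hf x)) i
  -- The recurrence links x ± 1 in entry i to x in entries i+1 and i+3, so it preserves the parity
  -- class of x + i being odd.
  let t : ℕ → ℤ → A := fun i x => if Odd (x + i) then (f x).1 i else 0
  have hS : ∀ i, neighborSum A (t i) = (4 : ℤ) • zigzag (ℤ → A) t i := by
    intro i
    ext x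
    have hz : zigzag (ℤ → A) t i x = if Even (x + i) then zigzag A (f x).1 i else 0 := by
      have o1 : Odd (x + (i + 1 : ℕ)) ↔ Even (x + i) := by
        simp only [Int.odd_iff, Int.even_iff]; push_cast; omega
      have o3 : Odd (x + (i + 3 : ℕ)) ↔ Even (x + i) := by
        simp only [Int.odd_iff, Int.even_iff]; push_cast; omega
      by_cases hi : Even i <;> by_cases hx : Even (x + i) <;>
        simp only [zigzag, t, AddMonoidHom.coe_mk, ZeroHom.coe_mk, hi, o1, o3, hx, if_true, if_false,
          Pi.sub_apply, sub_zero]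
    rw [Pi.smul_apply, hz]
    change (if Odd (x + 1 + i) then (f (x + 1)).1 i else 0) +
      (if Odd (x - 1 + i) then (f (x - 1)).1 i else 0) = _
    have o1 : Odd (x + 1 + i) ↔ Even (x + i) := by
      simp only [Int.odd_iff, Int.even_iff]; omega
    have o2 : Odd (x - 1 + i) ↔ Even (x + i) := by
      simp only [Int.odd_iff, Int.even_iff]; omega
    by_cases hx : Even (x + i)
    · simp only [o1, o2, hx, if_true, hf']
    · simp only [o1, o2, hx, if_false, add_zero, smul_zero]
  -- For i = 0, 1 the torsion exponent is 4^0 = 1.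
  have h01 : ∀ i, i / 2 = 0 → t i = 0 := fun i hi => funext fun x => by
    have := (f x).2.2.1 i
    rw [hi, pow_zero, one_smul] at this
    simp [t, this]
  refine ⟨⟨t, ⟨h01 0 rfl, h01 1 rfl, fun i hi => funext fun x => ?_, fun i x hx => ?_, hS⟩, ?_⟩, ?_⟩
  · simp [t, (f x).2.1 i hi]
  · exact if_neg (Int.not_odd_iff_even.2 hx)
  · ext i x
    have := congrFun (f x).2.2.2 i
    change (d : ℤ) • t i x = 0
    by_cases hx : Odd (x + i)
    · simp only [t, hx, if_true]
      exact this
    · simp [t, hx]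
  · ext i
    have hhi : h (i + 2) = τ i := dif_pos (⟨by omega, i.2⟩ : 2 ≤ i.val + 2 ∧ i.val + 2 - 2 < n)
    change t (i + 2) (if Even i.val then 1 else 0) = τ i
    rw [← hhi]
    by_cases hi : Even i.val
    · have : Odd ((1 : ℤ) + (i.val + 2 : ℕ)) := by simpa [parity_simps] using hi
      simp only [hi, if_true, t, this, hf1]
    · have : Odd ((0 : ℤ) + (i.val + 2 : ℕ)) := by simpa [parity_simps] using hi
      simp only [hi, if_false, t, this, hf0, if_true]

end Evaluation

/-! ### Torsion of ℚ/ℤ and assembly of the result -/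

theorem addCircle_torsion_mem_zmultiples {d : ℕ} (hd : d ≠ 0) {a : AddCircle (1 : ℚ)}
    (ha : (d : ℤ) • a = 0) : a ∈ AddSubgroup.zmultiples (((1 / d : ℚ)) : AddCircle (1 : ℚ)) := by
  induction a using QuotientAddGroup.induction_on with
  | H q =>
    rw [← AddCircle.coe_zsmul, AddCircle.coe_eq_zero_iff] at ha
    obtain ⟨k, hk⟩ := ha
    refine AddSubgroup.mem_zmultiples_iff.2 ⟨k, ?_⟩
    rw [← AddCircle.coe_zsmul]
    congr 1
    have : (d : ℚ) ≠ 0 := Nat.cast_ne_zero.2 hd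
    simp only [zsmul_eq_mul, Int.cast_natCast, mul_one] at hk ⊢
    rw [hk]
    field_simp

/-- The `d`-torsion of `ℚ/ℤ` is cyclic of order `d`. -/
theorem nonempty_torsionBy_addCircle_equiv {d : ℕ} (hd : d ≠ 0) :
    Nonempty (AddSubgroup.torsionBy (AddCircle (1 : ℚ)) (d : ℤ) ≃+ ZMod d) := by
  have hord : addOrderOf (((1 / d : ℚ)) : AddCircle (1 : ℚ)) = d :=
    AddCircle.addOrderOf_period_div (Nat.pos_of_ne_zero hd)
  have heq : AddSubgroup.torsionBy (AddCircle (1 : ℚ)) (d : ℤ) =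
      AddSubgroup.zmultiples (((1 / d : ℚ)) : AddCircle (1 : ℚ)) := by
    refine le_antisymm (fun a ha => addCircle_torsion_mem_zmultiples hd ha) ?_
    rw [AddSubgroup.zmultiples_le]
    change (d : ℤ) • (((1 / d : ℚ)) : AddCircle (1 : ℚ)) = 0
    rw [natCast_zsmul]
    nth_rw 1 [← hord]
    exact addOrderOf_nsmul_eq_zero _
  have hcard : Nat.card (AddSubgroup.torsionBy (AddCircle (1 : ℚ)) (d : ℤ)) = d := by
    rw [heq, Nat.card_zmultiples, hord]
  have hcyc : IsAddCyclic (AddSubgroup.torsionBy (AddCircle (1 : ℚ)) (d : ℤ)) := by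
    rw [heq]; infer_instance
  have e := zmodAddCyclicAddEquiv hcyc
  rw [hcard] at e
  exact ⟨e.symm⟩

/-- Splitting a family indexed by `Fin n` into its even and its odd part. -/
def splitParity {A : Type*} [AddCommGroup A] (M : ℕ → AddSubgroup A) (n : ℕ) :
    (∀ i : Fin n, M (i.val / 2)) →+
      (∀ j : Fin ((n + 1) / 2), M j.val) × (∀ j : Fin (n / 2), M j.val) where
  toFun τ :=
    (fun j => ⟨τ ⟨2 * j, by omega⟩,
        (SetLike.ext_iff.1 (congrArg M (show 2 * j.val / 2 = j by omega)) _).1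
          (τ ⟨2 * j, by omega⟩).2⟩,
      fun j => ⟨τ ⟨2 * j + 1, by omega⟩,
        (SetLike.ext_iff.1 (congrArg M (show (2 * j.val + 1) / 2 = j by omega)) _).1
          (τ ⟨2 * j + 1, by omega⟩).2⟩)
  map_zero' := rfl
  map_add' _ _ := rfl

theorem splitParity_bijective {A : Type*} [AddCommGroup A] (M : ℕ → AddSubgroup A) (n : ℕ) :
    Function.Bijective (splitParity M n) := by
  constructor
  · rw [injective_iff_map_eq_zero]
    intro τ hτ
    funext ⟨i, hi⟩
    refine Subtype.ext ?_
    obtain ⟨k, rfl | rfl⟩ := Nat.even_or_odd' i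
    · exact congrArg (fun z : M k => (z : A)) (congrFun (congrArg Prod.fst hτ) ⟨k, by omega⟩)
    · exact congrArg (fun z : M k => (z : A)) (congrFun (congrArg Prod.snd hτ) ⟨k, by omega⟩)
  · rintro ⟨p, q⟩
    refine ⟨fun i => if hi : Even i.val then p ⟨i / 2, by omega⟩ else
      q ⟨i / 2, by have := Nat.odd_iff.1 (Nat.not_even_iff_odd.1 hi); omega⟩, Prod.ext ?_ ?_⟩
    · ext j
      simp only [splitParity, AddMonoidHom.coe_mk, ZeroHom.coe_mk, even_two_mul, dif_pos]
      exact congrArg (fun k => (p k : A)) (Fin.ext (show 2 * j.val / 2 = j by omega))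
    · ext j
      have : ¬ Even (2 * j.val + 1) := by simp
      simp only [splitParity, AddMonoidHom.coe_mk, ZeroHom.coe_mk, this, dif_neg,
        not_false_eq_true]
      exact congrArg (fun k => (q k : A)) (Fin.ext (show (2 * j.val + 1) / 2 = j by omega))

theorem nonempty_U₀_equiv_torsion {m n d : ℕ} [NeZero m] {A : Type} [AddCommGroup A]
    (h : ∀ t ∈ zigzagSeq (neighborSum A) (paritySubgroup A) n,
      (∀ i x, t i (x + 2 * m) = t i x) ↔ (d : ℤ) • t = 0) :
    Nonempty ((stdNetwork (CLF' m n)).U₀ A ≃+ (∀ i : Fin n,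
      AddSubgroup.torsionBy A ((Nat.gcd (4 ^ (i.val / 2 + 1)) d : ℕ) : ℤ))) := by
  have e1 := U₀EquivHarmonicSeq m n A
  have e2 : harmonicSeq (neighborSum A) _ n ≃+ zigzagSeq (neighborSum A) _ n :=
    harmonicSeqEquivZigzagSeq (S := neighborSum A) (n := n)
      (G := fun j => paritySubgroup A j ⊓ periodicSubgroup A (2 * m))
      fun j => by simp only [paritySubgroup_add_two]
  have e3 := AddEquiv.addSubgroupCongr (mem_zigzagSeq_inf_periodic_iff h)
  have e4 := AddEquiv.ofBijective (torsionZigzagSeq.eval A n d)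
    ⟨torsionZigzagSeq.eval_injective n d, torsionZigzagSeq.eval_surjective n d⟩
  exact ⟨((e1.trans e2).trans e3).trans e4⟩

theorem mainTheorem5 (m n : ℕ) [NeZero m] :
    (Odd m →
      Nonempty ((stdNetwork (CLF' m n)).U₀ (AddCircle (1 : ℚ)) ≃+ (Fin n → ZMod 2))) ∧
    (Even m →
      Nonempty ((stdNetwork (CLF' m n)).U₀ (AddCircle (1 : ℚ)) ≃+
        (⨁ j : Fin ⌈(n : ℚ) / 2⌉₊, ZMod (Nat.gcd (4 ^ (j.val + 1)) (4 * m))) ×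
        (⨁ j : Fin ⌊(n : ℚ) / 2⌋₊, ZMod (Nat.gcd (4 ^ (j.val + 1)) (4 * m))))) := by
  refine ⟨fun hm => ?_, fun hm => ?_⟩
  · obtain ⟨e⟩ := nonempty_U₀_equiv_torsion (m := m) (n := n) (d := 2) (A := AddCircle (1 : ℚ))
      fun t ht => periodic_iff_of_odd ht.1 ht.2.1 ht.2.2.1 ht.2.2.2.2 hm
    have hg : ∀ i : Fin n, Nat.gcd (4 ^ (i.val / 2 + 1)) 2 = 2 := fun i =>
      Nat.gcd_eq_right ((by norm_num : 2 ∣ 4).trans (dvd_pow_self 4 (Nat.succ_ne_zero _)))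
    obtain ⟨e'⟩ := nonempty_torsionBy_addCircle_equiv two_ne_zero
    exact ⟨e.trans (AddEquiv.piCongrRight fun i =>
      (AddEquiv.addSubgroupCongr (by rw [hg, Nat.cast_two])).trans e')⟩
  · obtain ⟨e⟩ := nonempty_U₀_equiv_torsion (m := m) (n := n) (d := 4 * m)
      (A := AddCircle (1 : ℚ))
      fun t ht => periodic_iff_of_even ht.1 ht.2.1 ht.2.2.1 ht.2.2.2.2 (NeZero.ne m) hm
    have e2 := AddEquiv.ofBijective _ (splitParity_bijective
      (fun j => AddSubgroup.torsionBy (AddCircle (1 : ℚ))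
        ((Nat.gcd (4 ^ (j + 1)) (4 * m) : ℕ) : ℤ)) n)
    have hz : ∀ j : ℕ, Nonempty (AddSubgroup.torsionBy (AddCircle (1 : ℚ))
        ((Nat.gcd (4 ^ (j + 1)) (4 * m) : ℕ) : ℤ) ≃+ ZMod (Nat.gcd (4 ^ (j + 1)) (4 * m))) :=
      fun j => nonempty_torsionBy_addCircle_equiv
        (Nat.gcd_pos_of_pos_left _ (by positivity)).ne'
    have ez := fun j => (hz j).some
    have hceil : ⌈(n : ℚ) / 2⌉₊ = (n + 1) / 2 := by
      refine eq_of_forall_ge_iff fun c => ?_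
      rw [Nat.ceil_le, div_le_iff₀ two_pos]
      norm_cast
      omega
    have hfloor : ⌊(n : ℚ) / 2⌋₊ = n / 2 := by exact_mod_cast Nat.floor_div_eq_div (K := ℚ) n 2
    rw [hceil, hfloor]
    exact ⟨(e.trans e2).trans (((AddEquiv.piCongrRight fun j : Fin ((n + 1) / 2) => ez j).trans
      (DirectSum.addEquivProd _).symm).prodCongr
      ((AddEquiv.piCongrRight fun j : Fin (n / 2) => ez j).trans
      (DirectSum.addEquivProd _).symm))⟩
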